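/- Let $BS^{(2)} = \langle a,b,c \mid ab = ba^2,\ bc = cb^2\rangle$ be the iterated Baumslag–Solitar group. Words are finite strings over the alphabet $\{e, a^{\pm1}, b^{\pm1}, c^{\pm1}\}$, where the character $e$ stands for the identity; $|w|$ is the number of characters of $w$, and $K_{e,L}$ is the set of words $w$ with $|w| = L$ that represent the identity of $BS^{(2)}$. One step replaces a subword by the other side of one of the length-preserving relations $$ab\,e = baa,\qquad bc\,e = cbb,\qquad ss^{-1} = ee,\quad s^{-1}s = ee\ \ (s\in\{a,b,c\}),\qquad x\,e = e\,x\ \ (x \text{ any character}).$$ For words $w,w'$ of equal length that represent the same element, let $\mathsf{Dehn}(w,w')$ be the least $n$ such that, for some $m\ge 0$, the padded word $w e^m$ can be transformed into $w' e^m$ in $n$ steps. Let $$\mathsf{Dehn}(L) = \max_{w\in K_{e,L}} \mathsf{Dehn}(w, e^L),\qquad \mathsf{Dehn}_e(L) = \max_{w,w'\in K_{e,L}} \mathsf{Dehn}(w,w').$$ Then the Dehn function is doubly exponential, $\mathsf{Dehn}(L)\sim 2^{2^L}$, and likewise $\mathsf{Dehn}_e(L)\sim 2^{2^L}$. Here $d(L)\sim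 f(L)$ means that there is a constant $C>0$ such that $f(L/C)\le d(L)\le f(CL)$ for all sufficiently large $L$. -/

import Mathlib

namespace IteratedBS

open Filter

/-- The on-site alphabet of a group presentation with generators `S`: the trivial character
`e`, the generators and their formal inverses. -/
inductive Letter (S : Type) : Type
  | e : Letter S
  | gen (s : S) : Letter S
  | inv (s : S) : Letter S

/-- Words over the alphabet; the length `w.length` counts all characters, `e` included. -/
abbrev Word (S : Type) : Type := List (Letter S)

/-- The word `e^m`. -/
def trivialWord (S : Type) (m : ℕ) : Word S := List.replicate m Letter.e

/-- The element of the free group on `S` that is named by a character. -/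
def Letter.toFree {S : Type} : Letter S → FreeGroup S
  | Letter.e => 1
  | Letter.gen s => FreeGroup.of s
  | Letter.inv s => (FreeGroup.of s)⁻¹

/-- The element of the free group on `S` that is spelled by a word. -/
def Word.toFree {S : Type} (w : Word S) : FreeGroup S := (w.map Letter.toFree).prod

/-- The relators `l r⁻¹` of a set `R` of relations `l = r`. -/
def relators {S : Type} (R : Set (Word S × Word S)) : Set (FreeGroup S) :=
  {x | ∃ p ∈ R, x = Word.toFree p.1 * (Word.toFree p.2)⁻¹}

/-- The group `⟨S | R⟩`. -/
abbrev Grp {S : Type} (R : Set (Word S × Word S)) : Type := PresentedGroup (relators R)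

/-- The element `φ(w)` of `⟨S | R⟩` that is represented by the word `w`. -/
def eval {S : Type} (R : Set (Word S × Word S)) (w : Word S) : Grp R :=
  PresentedGroup.mk (relators R) (Word.toFree w)

/-- `K_{g,L}`: the words of length exactly `L` that represent `g`. -/
def sector {S : Type} (R : Set (Word S × Word S)) (g : Grp R) (L : ℕ) : Set (Word S) :=
  {w | w.length = L ∧ eval R w = g}

/-- The local relations: those in `R`, together with the trivial relations
`s s⁻¹ = e e`, `s⁻¹ s = e e` and `x e = e x`. -/
inductive LocalRelation {S : Type} (R : Set (Word S × Word S)) : Word S → Word S → Prop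
  | given {l r : Word S} (h : (l, r) ∈ R) : LocalRelation R l r
  | gen_inv (s : S) : LocalRelation R [Letter.gen s, Letter.inv s] [Letter.e, Letter.e]
  | inv_gen (s : S) : LocalRelation R [Letter.inv s, Letter.gen s] [Letter.e, Letter.e]
  | slide (x : Letter S) : LocalRelation R [x, Letter.e] [Letter.e, x]

/-- One arrow `u → v` of a derivation: a single relation is applied to a subword of `u`, from
left to right or from right to left. -/
def Step {S : Type} (R : Set (Word S × Word S)) (u v : Word S) : Prop :=
  ∃ p l r q : Word S, (LocalRelation R l r ∨ LocalRelation R r l) ∧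
    u = p ++ l ++ q ∧ v = p ++ r ++ q

/-- `Derivation R n u v`: there is a derivation from `u` to `v` with exactly `n` arrows. -/
inductive Derivation {S : Type} (R : Set (Word S × Word S)) : ℕ → Word S → Word S → Prop
  | refl (u : Word S) : Derivation R 0 u u
  | cons {n : ℕ} {u v w : Word S} (h : Step R u v) (d : Derivation R n v w) :
      Derivation R (n + 1) u w

/-- `Dehn(w, w')`: the least number of arrows of a derivation from `w` to `w'`. The available
space is not restricted: any number `m` of characters `e` may be appended to both words. The
value is `⊤` if there is no derivation. -/
noncomputable def dehnDist {S : Type} (R : Set (Word S × Word S)) (w w' : Word S) : ℕ∞ :=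
  ⨅ (n : ℕ) (_ : ∃ m : ℕ, Derivation R n (w ++ trivialWord S m) (w' ++ trivialWord S m)),
    (n : ℕ∞)

/-- `Dehn_g(L)`: the maximum of `Dehn(w, w')` over all `w, w'` in `K_{g,L}`. -/
noncomputable def dehnSector {S : Type} (R : Set (Word S × Word S)) (g : Grp R) (L : ℕ) : ℕ∞ :=
  ⨆ w ∈ sector R g L, ⨆ w' ∈ sector R g L, dehnDist R w w'

/-- `Dehn(L)`: the maximum of `Dehn(w, e^L)` over all `w` in `K_{e,L}`. -/
noncomputable def dehn {S : Type} (R : Set (Word S × Word S)) (L : ℕ) : ℕ∞ :=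
  ⨆ w ∈ sector R 1 L, dehnDist R w (trivialWord S L)

/-- `d(L) ∼ f(L)` in the scaling sense: `f(L / C) ≤ d(L) ≤ f(C L)` for some constant `C > 0`
and all sufficiently large `L`. -/
def ScalesAs (d : ℕ → ℕ∞) (f : ℝ → ℝ) : Prop :=
  ∃ C : ℝ, 0 < C ∧ ∀ᶠ L : ℕ in atTop,
    ENNReal.ofReal (f (L / C)) ≤ (d L : ENNReal) ∧
      (d L : ENNReal) ≤ ENNReal.ofReal (f (C * L))

/-- The three generators of the iterated Baumslag-Solitar group. -/
inductive Gen : Type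
  | a : Gen
  | b : Gen
  | c : Gen

/-- The relations `a b = b a²` and `b c = c b²`, padded by `e` so that both sides have the same
length: `a b e = b a a` and `b c e = c b b`. -/
def bs2 : Set (Word Gen × Word Gen) :=
  {([Letter.gen Gen.a, Letter.gen Gen.b, Letter.e],
      [Letter.gen Gen.b, Letter.gen Gen.a, Letter.gen Gen.a]),
    ([Letter.gen Gen.b, Letter.gen Gen.c, Letter.e],
      [Letter.gen Gen.c, Letter.gen Gen.b, Letter.gen Gen.b])}

end IteratedBS

/-! Upper bound. Letters are absorbed from right to left into a form `u c^ε₁ u₁ c^ε₂ u₂ ⋯` that is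
reduced in Britton's sense. A new `c^±1` either extends the sequence or closes one pinch, which
collapses to a power of `b` (`chain_pinch`). Each letter at most doubles the length bound, so
lengths stay below `2^L`. Collapsing a pinch is a computation in BS(1,2), where a word of length `ℓ`
reaches the form `b^i a^m b^{-j}` in `O(2^ℓ)` moves (`exists_chain_bsForm`); the total is
`O(2^(2^L))`. If the word is trivial, Britton's lemma in `Model` leaves no `c`, and the remaining
word collapses in BS(1,2). Converting moves into steps with padding roughly squares the count
(`Chain.dehnDist_le`), which the constant in `ScalesAs` absorbs.

Lower bound. `edgeWeight` is a 1-cochain on the `a`-edges whose coboundary is at most 1 on every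
relation, so the weight of a word bounds the number of steps to the trivial word from below. The
commutator `[u⁻¹ a u, a]` with `u = c^{-n} b c^n` is trivial because `u⁻¹ a u = a^(2^(2^n))`; it has
length `8n + 8` but weight `2^(2^n - 1)` (`wordWeight_commutatorWord`). -/

namespace IteratedBS

open Filter

/-! ### Words, their values, and steps. -/

section Words

variable {S : Type}

@[simp] theorem Word.toFree_nil : Word.toFree ([] : Word S) = 1 := rfl

@[simp] theorem Word.toFree_cons (x : Letter S) (w : Word S) :
    Word.toFree (x :: w) = x.toFree * Word.toFree w := by
  simp [Word.toFree]

@[simp] theorem Word.toFree_append (u v : Word S) :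
    Word.toFree (u ++ v) = Word.toFree u * Word.toFree v := by
  simp [Word.toFree]

/-- The value of a word under an interpretation of the generators in a group. -/
def wordValue {H : Type*} [Group H] (f : S → H) (w : Word S) : H :=
  FreeGroup.lift f (Word.toFree w)

variable {H : Type*} [Group H] (f : S → H)

@[simp] theorem wordValue_nil : wordValue f [] = 1 := by simp [wordValue]

@[simp] theorem wordValue_append (u v : Word S) :
    wordValue f (u ++ v) = wordValue f u * wordValue f v := by simp [wordValue]

@[simp] theorem wordValue_e (w : Word S) :
    wordValue f (Letter.e :: w) = wordValue f w := by simp [wordValue, Letter.toFree]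

@[simp] theorem wordValue_gen (s : S) (w : Word S) :
    wordValue f (Letter.gen s :: w) = f s * wordValue f w := by simp [wordValue, Letter.toFree]

@[simp] theorem wordValue_inv (s : S) (w : Word S) :
    wordValue f (Letter.inv s :: w) = (f s)⁻¹ * wordValue f w := by
  simp [wordValue, Letter.toFree]

@[simp] theorem wordValue_trivialWord (m : ℕ) : wordValue f (trivialWord S m) = 1 := by
  induction m with
  | zero => simp [trivialWord]
  | succ m ih => simpa [trivialWord, List.replicate_succ] using ih

@[simp] theorem length_trivialWord (m : ℕ) : (trivialWord S m).length = m := by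
  simp [trivialWord]

theorem trivialWord_succ (m : ℕ) :
    trivialWord S (m + 1) = Letter.e :: trivialWord S m := rfl

variable {f} {R : Set (Word S × Word S)}

theorem wordValue_localRelation (hR : ∀ p ∈ R, wordValue f p.1 = wordValue f p.2)
    {l r : Word S} (h : LocalRelation R l r) : wordValue f l = wordValue f r := by
  cases h with
  | given h => exact hR _ h
  | gen_inv s => simp
  | inv_gen s => simp
  | slide x => cases x <;> simp

theorem wordValue_eq_one_of_eval (hR : ∀ p ∈ R, wordValue f p.1 = wordValue f p.2)
    {w : Word S} (h : eval R w = 1) : wordValue f w = 1 := by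
  have hr : ∀ r ∈ relators R, FreeGroup.lift f r = 1 := by
    rintro r ⟨p, hp, rfl⟩
    have := hR p hp
    simp only [wordValue] at this
    simp [this]
  have := congrArg (PresentedGroup.toGroup hr) h
  rw [map_one] at this
  exact this

theorem eval_eq_wordValue (w : Word S) :
    eval R w = wordValue (fun s => (PresentedGroup.of s : Grp R)) w := by
  unfold eval wordValue
  refine DFunLike.congr_fun (f := PresentedGroup.mk (relators R))
    (g := FreeGroup.lift fun s => (PresentedGroup.of s : Grp R)) ?_ _
  ext s
  simp [PresentedGroup.of]

theorem eval_eq_of_mem {l r : Word S} (h : (l, r) ∈ R) : eval R l = eval R r := by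
  have : PresentedGroup.mk (relators R) (l.toFree * r.toFree⁻¹) = 1 :=
    PresentedGroup.one_of_mem ⟨(l, r), h, rfl⟩
  rw [map_mul, map_inv, mul_inv_eq_one] at this
  exact this

theorem Step.wordValue_eq (hR : ∀ p ∈ R, wordValue f p.1 = wordValue f p.2)
    {u v : Word S} (h : Step R u v) : wordValue f u = wordValue f v := by
  obtain ⟨p, l, r, q, h, rfl, rfl⟩ := h
  have : wordValue f l = wordValue f r := by
    rcases h with h | h
    · exact wordValue_localRelation hR h
    · exact (wordValue_localRelation hR h).symm
  simp [this]

theorem Step.symm {u v : Word S} (h : Step R u v) : Step R v u := by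
  obtain ⟨p, l, r, q, h, hu, hv⟩ := h
  exact ⟨p, r, l, q, h.symm, hv, hu⟩

theorem Step.append {u v : Word S} (h : Step R u v) (p q : Word S) :
    Step R (p ++ u ++ q) (p ++ v ++ q) := by
  obtain ⟨p', l, r, q', h, rfl, rfl⟩ := h
  exact ⟨p ++ p', l, r, q' ++ q, h, by simp, by simp⟩

theorem LocalRelation.step {l r : Word S} (h : LocalRelation R l r) : Step R l r :=
  ⟨[], l, r, [], Or.inl h, by simp, by simp⟩

/-- The relations have sides of equal length. -/
def LengthPreserving (R : Set (Word S × Word S)) : Prop :=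
  ∀ p ∈ R, p.1.length = p.2.length

theorem Step.length_eq (hR : LengthPreserving R) {u v : Word S} (h : Step R u v) :
    u.length = v.length := by
  obtain ⟨p, l, r, q, h, rfl, rfl⟩ := h
  have key : ∀ {l r : Word S}, LocalRelation R l r → l.length = r.length := by
    intro l r h
    cases h with
    | given h => exact hR _ h
    | gen_inv s => rfl
    | inv_gen s => rfl
    | slide x => rfl
  have : l.length = r.length := h.elim key fun h => (key h).symm
  simp [this]

theorem Derivation.trans {m n : ℕ} {u v w : Word S} (h : Derivation R m u v)
    (h' : Derivation R n v w) : Derivation R (m + n) u w := by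
  induction h with
  | refl u => simpa using h'
  | cons h d ih =>
    rw [Nat.add_right_comm]
    exact .cons h (ih h')

theorem Derivation.symm {n : ℕ} {u v : Word S} (h : Derivation R n u v) :
    Derivation R n v u := by
  induction h with
  | refl u => exact .refl u
  | cons h d ih => exact ih.trans (.cons h.symm (.refl _))

theorem Derivation.append {n : ℕ} {u v : Word S} (h : Derivation R n u v) (p q : Word S) :
    Derivation R n (p ++ u ++ q) (p ++ v ++ q) := by
  induction h with
  | refl u => exact .refl _
  | cons h d ih => exact .cons (h.append p q) ih

theorem derivation_slide (q : Word S) :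
    Derivation R q.length (q ++ [Letter.e]) (Letter.e :: q) := by
  induction q with
  | nil => exact .refl _
  | cons x q ih =>
    have h1 : Derivation R q.length (x :: q ++ [Letter.e]) (x :: Letter.e :: q) := by
      simpa using ih.append [x] []
    have h2 : Step R (x :: Letter.e :: q) (Letter.e :: x :: q) := by
      simpa using (LocalRelation.slide x).step.append [] q
    exact h1.trans (.cons h2 (.refl _))

/-! ### Moves with free `e`, and their cost in derivations. -/

/-- A move is a step, or the insertion or deletion of one character `e`. -/
inductive Move (R : Set (Word S × Word S)) : Word S → Word S → Prop
  | step {u v : Word S} (h : Step R u v) : Move R u v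
  | insert (p q : Word S) : Move R (p ++ q) (p ++ Letter.e :: q)
  | delete (p q : Word S) : Move R (p ++ Letter.e :: q) (p ++ q)

theorem Move.symm {u v : Word S} (h : Move R u v) : Move R v u := by
  cases h with
  | step h => exact .step h.symm
  | insert p q => exact .delete p q
  | delete p q => exact .insert p q

theorem Move.append {u v : Word S} (h : Move R u v) (p q : Word S) :
    Move R (p ++ u ++ q) (p ++ v ++ q) := by
  cases h with
  | step h => exact .step (h.append p q)
  | insert p' q' => simpa using Move.insert (R := R) (p ++ p') (q' ++ q)
  | delete p' q' => simpa using Move.delete (R := R) (p ++ p') (q' ++ q)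

theorem Move.length_le (hR : LengthPreserving R) {u v : Word S} (h : Move R u v) :
    v.length ≤ u.length + 1 := by
  cases h with
  | step h => rw [h.length_eq hR]; omega
  | insert p q => simp; omega
  | delete p q => simp; omega

theorem Move.wordValue_eq (hR : ∀ p ∈ R, wordValue f p.1 = wordValue f p.2)
    {u v : Word S} (h : Move R u v) : wordValue f u = wordValue f v := by
  cases h with
  | step h => exact h.wordValue_eq hR
  | insert p q => simp
  | delete p q => simp

/-- The word `w`, filled up with characters `e` to length `N`. -/
def padTo (N : ℕ) (w : Word S) : Word S := w ++ trivialWord S (N - w.length)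

/-- The padding keeps spare `e`s at the right end. An insertion between `p` and `q` slides one of
them left through `q`; a deletion is the reverse. -/
theorem Move.derivation (hR : LengthPreserving R) {N : ℕ} {u v : Word S} (h : Move R u v)
    (hu : u.length ≤ N) (hv : v.length ≤ N) :
    ∃ k ≤ N + 1, Derivation R k (padTo N u) (padTo N v) := by
  have key : ∀ p q : Word S, (p ++ Letter.e :: q).length ≤ N →
      ∃ k ≤ N + 1, Derivation R k (padTo N (p ++ q)) (padTo N (p ++ Letter.e :: q)) := by
    intro p q h
    refine ⟨q.length, by simp at h; omega, ?_⟩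
    have := (derivation_slide (R := R) q).append p
      (trivialWord S (N - (p ++ Letter.e :: q).length))
    have e : N - (p ++ q).length = (N - (p ++ Letter.e :: q).length) + 1 := by
      simp at h ⊢; omega
    rw [padTo, padTo, e, trivialWord_succ]
    simpa using this
  cases h with
  | step h =>
    refine ⟨1, by omega, .cons ?_ (.refl _)⟩
    unfold padTo
    rw [h.length_eq hR]
    simpa using h.append [] (trivialWord S (N - v.length))
  | insert p q => exact key p q hv
  | delete p q =>
    obtain ⟨k, hk, d⟩ := key p q hu
    exact ⟨k, hk, d.symm⟩

/-- `Chain R n u v`: the word `u` can be transformed into `v` by at most `n` moves. -/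
inductive Chain (R : Set (Word S × Word S)) : ℕ → Word S → Word S → Prop
  | refl (n : ℕ) (u : Word S) : Chain R n u u
  | cons {n : ℕ} {u v w : Word S} (h : Move R u v) (d : Chain R n v w) : Chain R (n + 1) u w

theorem Chain.mono {m n : ℕ} {u v : Word S} (h : Chain R m u v) (hmn : m ≤ n) :
    Chain R n u v := by
  induction h generalizing n with
  | refl m u => exact .refl _ _
  | cons h d ih =>
    cases n with
    | zero => omega
    | succ n => exact .cons h (ih (by omega))

theorem Chain.trans {m n : ℕ} {u v w : Word S} (h : Chain R m u v) (h' : Chain R n v w) :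
    Chain R (m + n) u w := by
  induction h with
  | refl m u => exact h'.mono (by omega)
  | cons h d ih =>
    rw [Nat.add_right_comm]
    exact .cons h (ih h')

theorem Move.chain {u v : Word S} (h : Move R u v) : Chain R 1 u v := .cons h (.refl 0 _)

theorem Chain.symm {n : ℕ} {u v : Word S} (h : Chain R n u v) : Chain R n v u := by
  induction h with
  | refl m u => exact .refl _ _
  | cons h d ih => exact ih.trans h.symm.chain

theorem Chain.append {n : ℕ} {u v : Word S} (h : Chain R n u v) (p q : Word S) :
    Chain R n (p ++ u ++ q) (p ++ v ++ q) := by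
  induction h with
  | refl n u => exact .refl _ _
  | cons h d ih => exact .cons (h.append p q) ih

theorem Chain.append_right {n : ℕ} {u v : Word S} (h : Chain R n u v) (q : Word S) :
    Chain R n (u ++ q) (v ++ q) := by simpa using h.append [] q

theorem Chain.append_left {n : ℕ} {u v : Word S} (h : Chain R n u v) (p : Word S) :
    Chain R n (p ++ u) (p ++ v) := by simpa using h.append p []

theorem Chain.cons_left {n : ℕ} {u v : Word S} (h : Chain R n u v) (x : Letter S) :
    Chain R n (x :: u) (x :: v) := h.append_left [x]

theorem Chain.wordValue_eq (hR : ∀ p ∈ R, wordValue f p.1 = wordValue f p.2)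
    {n : ℕ} {u v : Word S} (h : Chain R n u v) : wordValue f u = wordValue f v := by
  induction h with
  | refl n u => rfl
  | cons h d ih => exact (h.wordValue_eq hR).trans ih

theorem Chain.derivation (hR : LengthPreserving R) {N n : ℕ} {u v : Word S}
    (h : Chain R n u v) (hN : u.length + n ≤ N) :
    ∃ k ≤ n * (N + 1), Derivation R k (padTo N u) (padTo N v) := by
  induction h with
  | refl n u => exact ⟨0, by omega, .refl _⟩
  | @cons n u v w h d ih =>
    have hv := h.length_le hR
    obtain ⟨k, hk, d₁⟩ := h.derivation hR (N := N) (by omega) (by omega)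
    obtain ⟨l, hl, d₂⟩ := ih (by omega)
    refine ⟨k + l, ?_, d₁.trans d₂⟩
    rw [add_mul]
    omega

/-- A move lengthens a word by at most one, so `n` spare characters suffice, and each move costs at
most `L + n + 1` steps. -/
theorem Chain.dehnDist_le (hR : LengthPreserving R) {L n : ℕ} {u v : Word S}
    (h : Chain R n u v) (hu : u.length = L) (hv : v.length = L) :
    dehnDist R u v ≤ (n * (L + n + 1) : ℕ) := by
  obtain ⟨k, hk, d⟩ := h.derivation hR (N := L + n) (by omega)
  refine le_trans (iInf₂_le k ⟨n, ?_⟩) (by exact_mod_cast hk)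
  simpa [padTo, hu, hv] using d

theorem dehn_le_dehnSector (L : ℕ) : dehn R L ≤ dehnSector R 1 L := by
  refine iSup₂_mono fun w hw => ?_
  refine le_iSup₂_of_le (trivialWord S L) ⟨by simp, ?_⟩ le_rfl
  rw [eval_eq_wordValue, wordValue_trivialWord]

end Words

/-! ### Powers of a generator and the relation `s t = t s²`. -/

section Powers

variable {S : Type} {R : Set (Word S × Word S)}

/-- The reduced word for the power `s ^ k` of a generator. -/
def letterPow (s : S) : ℤ → Word S
  | Int.ofNat n => List.replicate n (Letter.gen s)
  | Int.negSucc n => List.replicate (n + 1) (Letter.inv s)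

theorem letterPow_natCast (s : S) (n : ℕ) :
    letterPow s (n : ℤ) = List.replicate n (Letter.gen s) := rfl

theorem letterPow_neg_natCast (s : S) (n : ℕ) :
    letterPow s (-(n : ℤ)) = List.replicate n (Letter.inv s) := by
  cases n <;> rfl

@[simp] theorem letterPow_zero (s : S) : letterPow s 0 = [] := rfl

@[simp] theorem length_letterPow (s : S) (k : ℤ) : (letterPow s k).length = k.natAbs := by
  cases k <;> simp [letterPow]

theorem mem_letterPow {s : S} {k : ℤ} {x : Letter S} (h : x ∈ letterPow s k) :
    x = Letter.gen s ∨ x = Letter.inv s := by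
  cases k <;> simp [letterPow] at h <;> simp [h]

theorem wordValue_replicate_gen {H : Type*} [Group H] (f : S → H) (s : S) (n : ℕ) :
    wordValue f (List.replicate n (Letter.gen s)) = f s ^ n := by
  induction n with
  | zero => simp
  | succ n ih => simp [List.replicate_succ, ih, pow_succ']

theorem wordValue_replicate_inv {H : Type*} [Group H] (f : S → H) (s : S) (n : ℕ) :
    wordValue f (List.replicate n (Letter.inv s)) = (f s ^ n)⁻¹ := by
  induction n with
  | zero => simp
  | succ n ih => simp [List.replicate_succ, ih, pow_succ]

@[simp] theorem wordValue_letterPow {H : Type*} [Group H] (f : S → H) (s : S) (k : ℤ) :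
    wordValue f (letterPow s k) = f s ^ k := by
  cases k with
  | ofNat n => simp [letterPow, wordValue_replicate_gen]
  | negSucc n => simp only [letterPow, wordValue_replicate_inv, zpow_negSucc]

theorem chain_gen_inv (s : S) (p q : Word S) :
    Chain R 3 (p ++ Letter.gen s :: Letter.inv s :: q) (p ++ q) := by
  have h : Step R (p ++ Letter.gen s :: Letter.inv s :: q) (p ++ Letter.e :: Letter.e :: q) := by
    simpa using (LocalRelation.gen_inv s).step.append p q
  exact .cons (.step h) (.cons (.delete _ _) (.cons (.delete _ _) (.refl _ _)))

theorem chain_inv_gen (s : S) (p q : Word S) :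
    Chain R 3 (p ++ Letter.inv s :: Letter.gen s :: q) (p ++ q) := by
  have h : Step R (p ++ Letter.inv s :: Letter.gen s :: q) (p ++ Letter.e :: Letter.e :: q) := by
    simpa using (LocalRelation.inv_gen s).step.append p q
  exact .cons (.step h) (.cons (.delete _ _) (.cons (.delete _ _) (.refl _ _)))

theorem chain_gen_letterPow (s : S) (k : ℤ) :
    Chain R 3 (Letter.gen s :: letterPow s k) (letterPow s (1 + k)) := by
  cases k with
  | ofNat n =>
    have e : 1 + Int.ofNat n = Int.ofNat (n + 1) := by simp [add_comm]
    rw [e]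
    exact .refl _ _
  | negSucc n =>
    have e : 1 + Int.negSucc n = -(n : ℤ) := by omega
    rw [e, letterPow_neg_natCast]
    exact chain_gen_inv s [] _

theorem chain_inv_letterPow (s : S) (k : ℤ) :
    Chain R 3 (Letter.inv s :: letterPow s k) (letterPow s (-1 + k)) := by
  rcases le_or_gt k 0 with hk | hk
  · obtain ⟨n, rfl⟩ := Int.exists_eq_neg_ofNat hk
    have e : -1 + -(n : ℤ) = -((n + 1 : ℕ) : ℤ) := by push_cast; ring
    rw [e, letterPow_neg_natCast, letterPow_neg_natCast]
    exact .refl _ _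
  · obtain ⟨n, rfl⟩ : ∃ n : ℕ, k = ((n + 1 : ℕ) : ℤ) := ⟨(k - 1).toNat, by omega⟩
    have e : -1 + ((n + 1 : ℕ) : ℤ) = (n : ℤ) := by push_cast; ring
    rw [e, letterPow_natCast, letterPow_natCast]
    exact chain_inv_gen s [] _

theorem chain_letterPow_append (s : S) (j k : ℤ) :
    Chain R (3 * j.natAbs) (letterPow s j ++ letterPow s k) (letterPow s (j + k)) := by
  rcases Int.eq_nat_or_neg j with ⟨n, rfl | rfl⟩
  · rw [Int.natAbs_natCast]
    induction n with
    | zero => simpa using Chain.refl _ _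
    | succ n ih =>
      have e : ((n + 1 : ℕ) : ℤ) + k = 1 + (n + k) := by push_cast; ring
      rw [e]
      exact (ih.cons_left (Letter.gen s)).trans (chain_gen_letterPow s _)
  · rw [Int.natAbs_neg, Int.natAbs_natCast]
    induction n with
    | zero => simpa using Chain.refl _ _
    | succ n ih =>
      have e : -((n + 1 : ℕ) : ℤ) + k = -1 + (-n + k) := by push_cast; ring
      rw [e]
      rw [letterPow_neg_natCast] at ih ⊢
      exact (ih.cons_left (Letter.inv s)).trans (chain_inv_letterPow s _)

theorem chain_replicate_conj {x t : Letter S} {K : ℕ} (h : Chain R K [x, t] [t, x, x]) (n : ℕ) :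
    Chain R (K * n) (List.replicate n x ++ [t]) (t :: List.replicate (2 * n) x) := by
  induction n with
  | zero => exact .refl _ _
  | succ n ih =>
    have := (ih.cons_left x).trans (h.append_right (List.replicate (2 * n) x))
    exact this

variable {s t : S}
  (hst : ([Letter.gen s, Letter.gen t, Letter.e], [Letter.gen t, Letter.gen s, Letter.gen s]) ∈ R)

include hst

theorem chain_gen_conj :
    Chain R 2 [Letter.gen s, Letter.gen t] [Letter.gen t, Letter.gen s, Letter.gen s] :=
  .cons (.insert [Letter.gen s, Letter.gen t] [])
    (.cons (.step (LocalRelation.given hst).step) (.refl _ _))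

/-- Insert `s² s⁻²` after `t`, apply the relation backwards to `t s s`, and cancel `s⁻¹ s`. -/
theorem chain_inv_conj :
    Chain R 11 [Letter.inv s, Letter.gen t] [Letter.gen t, Letter.inv s, Letter.inv s] := by
  have h₁ : Chain R 3 [Letter.inv s, Letter.gen t]
      [Letter.inv s, Letter.gen t, Letter.gen s, Letter.inv s] :=
    (chain_gen_inv s [Letter.inv s, Letter.gen t] []).symm
  have h₂ : Chain R 3 [Letter.inv s, Letter.gen t, Letter.gen s, Letter.inv s]
      [Letter.inv s, Letter.gen t, Letter.gen s, Letter.gen s, Letter.inv s, Letter.inv s] :=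
    (chain_gen_inv s [Letter.inv s, Letter.gen t, Letter.gen s] [Letter.inv s]).symm
  have h₃ : Chain R 2
      [Letter.inv s, Letter.gen t, Letter.gen s, Letter.gen s, Letter.inv s, Letter.inv s]
      [Letter.inv s, Letter.gen s, Letter.gen t, Letter.inv s, Letter.inv s] :=
    (chain_gen_conj hst).symm.append [Letter.inv s] [Letter.inv s, Letter.inv s]
  have h₄ : Chain R 3 [Letter.inv s, Letter.gen s, Letter.gen t, Letter.inv s, Letter.inv s]
      [Letter.gen t, Letter.inv s, Letter.inv s] := chain_inv_gen s [] _
  exact h₁.trans (h₂.trans (h₃.trans h₄))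

/-- The relation `s t = t s²` moves `t` to the left across a power of `s`. -/
theorem chain_letterPow_conj (m : ℤ) :
    Chain R (11 * m.natAbs) (letterPow s m ++ [Letter.gen t])
      (Letter.gen t :: letterPow s (2 * m)) := by
  rcases Int.eq_nat_or_neg m with ⟨n, rfl | rfl⟩
  · exact chain_replicate_conj ((chain_gen_conj hst).mono (by norm_num)) n
  · have e : 2 * -(n : ℤ) = -((2 * n : ℕ) : ℤ) := by push_cast; ring
    rw [e, letterPow_neg_natCast, letterPow_neg_natCast, Int.natAbs_neg, Int.natAbs_natCast]
    exact chain_replicate_conj (chain_inv_conj hst) n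

theorem chain_inv_letterPow_conj (m : ℤ) :
    Chain R (11 * m.natAbs + 6) (Letter.inv t :: letterPow s m)
      (letterPow s (2 * m) ++ [Letter.inv t]) := by
  have h₁ : Chain R 3 (Letter.inv t :: letterPow s m)
      (Letter.inv t :: (letterPow s m ++ [Letter.gen t]) ++ [Letter.inv t]) := by
    simpa using (chain_gen_inv t (Letter.inv t :: letterPow s m) []).symm
  have h₂ := ((chain_letterPow_conj hst m).cons_left (Letter.inv t)).append_right [Letter.inv t]
  have h₃ : Chain R 3 (Letter.inv t :: Letter.gen t :: letterPow s (2 * m) ++ [Letter.inv t])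
      (letterPow s (2 * m) ++ [Letter.inv t]) := chain_inv_gen t [] _
  exact (h₁.trans (h₂.trans h₃)).mono (by omega)

/-- The exponent doubles at each `t`, so the cost is the geometric sum `11 |m| (1 + 2 + ⋯ +
2^(i-1))`. -/
theorem chain_letterPow_conj_replicate (m : ℤ) (i : ℕ) :
    Chain R (11 * m.natAbs * (2 ^ i - 1)) (letterPow s m ++ List.replicate i (Letter.gen t))
      (List.replicate i (Letter.gen t) ++ letterPow s (2 ^ i * m)) := by
  induction i generalizing m with
  | zero => simpa using Chain.refl _ _
  | succ i ih =>
    have h₁ := (chain_letterPow_conj hst m).append_right (List.replicate i (Letter.gen t))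
    have h₂ := (ih (2 * m)).cons_left (Letter.gen t)
    have e : 2 ^ i * (2 * m) = 2 ^ (i + 1) * m := by ring
    rw [e] at h₂
    rw [List.append_assoc] at h₁
    refine (h₁.trans h₂).mono ?_
    obtain ⟨k, hk⟩ := Nat.exists_eq_add_of_le' (Nat.one_le_two_pow (n := i))
    rw [Int.natAbs_mul, pow_succ, hk]
    have : (k + 1) * 2 - 1 = 2 * k + 1 := by omega
    rw [this]
    simp
    nlinarith

end Powers

theorem lengthPreserving_bs2 : LengthPreserving bs2 := by
  rintro p (rfl | rfl) <;> rfl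

theorem ab_mem_bs2 : ([Letter.gen Gen.a, Letter.gen Gen.b, Letter.e],
    [Letter.gen Gen.b, Letter.gen Gen.a, Letter.gen Gen.a]) ∈ bs2 := Or.inl rfl

theorem bc_mem_bs2 : ([Letter.gen Gen.b, Letter.gen Gen.c, Letter.e],
    [Letter.gen Gen.c, Letter.gen Gen.b, Letter.gen Gen.b]) ∈ bs2 := Or.inr rfl

/-! ### An HNN extension in which values can be computed. -/

section Model

/-- The translation `x ↦ x + 1`. -/
def shift : Equiv.Perm ℚ := Equiv.addRight 1

/-- The contraction `x ↦ x / 2`. -/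
def halve : Equiv.Perm ℚ := Equiv.divRight₀ 2 two_ne_zero

@[simp] theorem shift_apply (x : ℚ) : shift x = x + 1 := rfl

@[simp] theorem halve_apply (x : ℚ) : halve x = x / 2 := rfl

@[simp] theorem shift_zpow_apply (k : ℤ) (x : ℚ) : (shift ^ k) x = x + k := by
  induction k generalizing x with
  | zero => simp
  | succ n ih => rw [zpow_add_one, Equiv.Perm.mul_apply, ih, shift_apply]; push_cast; ring
  | pred n ih =>
    have h : (shift⁻¹ : Equiv.Perm ℚ) x = x - 1 := by
      rw [Equiv.Perm.inv_eq_iff_eq, shift_apply]; ring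
    rw [zpow_sub_one, Equiv.Perm.mul_apply, ih, h]; push_cast; ring

@[simp] theorem halve_zpow_apply (k : ℤ) (x : ℚ) : (halve ^ k) x = x / 2 ^ k := by
  induction k generalizing x with
  | zero => simp
  | succ n ih =>
    rw [zpow_add_one, Equiv.Perm.mul_apply, ih, halve_apply, zpow_add_one₀ two_ne_zero]
    field_simp
  | pred n ih =>
    have h : (halve⁻¹ : Equiv.Perm ℚ) x = x * 2 := by
      rw [Equiv.Perm.inv_eq_iff_eq, halve_apply]; ring
    rw [zpow_sub_one, Equiv.Perm.mul_apply, ih, h, zpow_sub_one₀ two_ne_zero]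
    field_simp

theorem halve_zpow_injective : Function.Injective fun k : ℤ => halve ^ k := by
  intro k l h
  have h := DFunLike.congr_fun h (1 : ℚ)
  simp only [halve_zpow_apply, one_div, inv_inj] at h
  exact zpow_right_injective₀ (by norm_num) (by norm_num) h

/-- Infinite order of `halve`, and then of its square, is what makes `b² ↦ b` an isomorphism of the
associated subgroups. -/
theorem zpowersHom_halve_injective :
    Function.Injective (zpowersHom (Equiv.Perm ℚ) halve) := by
  intro k l h
  have h' : halve ^ k.toAdd = halve ^ l.toAdd := by simpa [zpowersHom_apply] using h
  exact Multiplicative.toAdd.injective (halve_zpow_injective h')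

theorem zpowersHom_halve_sq_injective :
    Function.Injective (zpowersHom (Equiv.Perm ℚ) (halve ^ (2 : ℤ))) := by
  intro k l h
  have h' : halve ^ (2 * k.toAdd) = halve ^ (2 * l.toAdd) := by
    simpa [zpowersHom_apply, zpow_mul] using h
  have := halve_zpow_injective h'
  exact Multiplicative.toAdd.injective (by omega)

/-- The subgroup `⟨b²⟩`. -/
abbrev halveSqPowers : Subgroup (Equiv.Perm ℚ) :=
  (zpowersHom (Equiv.Perm ℚ) (halve ^ (2 : ℤ))).range

/-- The subgroup `⟨b⟩`. -/
abbrev halvePowers : Subgroup (Equiv.Perm ℚ) := (zpowersHom (Equiv.Perm ℚ) halve).range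

/-- The isomorphism `⟨b²⟩ ≃ ⟨b⟩` that sends `b²` to `b`. -/
noncomputable def sqEquiv : halveSqPowers ≃* halvePowers :=
  (MonoidHom.ofInjective zpowersHom_halve_sq_injective).symm.trans
    (MonoidHom.ofInjective zpowersHom_halve_injective)

/-- An HNN extension of a group of permutations of `ℚ` in which the relations of the iterated
Baumslag-Solitar group hold. -/
abbrev Model : Type := HNNExtension (Equiv.Perm ℚ) halveSqPowers halvePowers sqEquiv

/-- The interpretation of the generators `a` and `b` as permutations of `ℚ`. -/
def genPerm : Gen → Equiv.Perm ℚ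
  | Gen.a => shift
  | Gen.b => halve
  | Gen.c => 1

/-- The interpretation of the generators in the HNN extension. -/
noncomputable def genModel : Gen → Model
  | Gen.a => HNNExtension.of shift
  | Gen.b => HNNExtension.of halve
  | Gen.c => HNNExtension.t

theorem halve_mul_t : (HNNExtension.of halve * HNNExtension.t : Model) =
    HNNExtension.t * (HNNExtension.of halve * HNNExtension.of halve) := by
  have h := HNNExtension.t_mul_of (φ := sqEquiv)
    (MonoidHom.ofInjective zpowersHom_halve_sq_injective (Multiplicative.ofAdd 1))
  have e : sqEquiv (MonoidHom.ofInjective zpowersHom_halve_sq_injective (Multiplicative.ofAdd 1))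
      = MonoidHom.ofInjective zpowersHom_halve_injective (Multiplicative.ofAdd 1) := by
    simp [sqEquiv]
  rw [e] at h
  simp only [MonoidHom.ofInjective_apply, zpowersHom_apply, toAdd_ofAdd, zpow_one] at h
  rw [← h, ← map_mul]
  rfl

theorem genModel_relations :
    ∀ p ∈ bs2, wordValue genModel p.1 = wordValue genModel p.2 := by
  rintro p (rfl | rfl)
  · have : shift * halve = halve * (shift * shift) := by
      ext x; simp [Equiv.Perm.mul_apply]; ring
    simp [genModel, ← map_mul, this]
  · simpa [genModel] using halve_mul_t

/-- The word contains no `c` and no `c⁻¹`. -/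
def AvoidsC (w : Word Gen) : Prop := ∀ x ∈ w, x ≠ Letter.gen Gen.c ∧ x ≠ Letter.inv Gen.c

theorem AvoidsC.append {u v : Word Gen} (hu : AvoidsC u) (hv : AvoidsC v) :
    AvoidsC (u ++ v) := by
  intro x hx
  rcases List.mem_append.1 hx with h | h
  exacts [hu x h, hv x h]

theorem avoidsC_letterPow (k : ℤ) : AvoidsC (letterPow Gen.b k) := by
  intro x hx
  rcases mem_letterPow hx with rfl | rfl <;> simp

/-- The restriction is needed because `genPerm` gives `c` the junk value `1`. -/
theorem AvoidsC.of_wordValue {w : Word Gen} (hw : AvoidsC w) :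
    (HNNExtension.of (wordValue genPerm w) : Model) = wordValue genModel w := by
  induction w with
  | nil => simp
  | cons x w ih =>
    have ih := ih fun y hy => hw y (List.mem_cons_of_mem _ hy)
    have hx := hw x List.mem_cons_self
    rcases x with _ | (_ | _ | _) | (_ | _ | _) <;> simp_all [genPerm, genModel]

end Model

/-! ### Words without `c`: exponential rewriting in BS(1,2). -/

section BaumslagSolitar

/-- The word `b^i a^m b^{-j}`. -/
def bsForm (i : ℕ) (m : ℤ) (j : ℕ) : Word Gen :=
  List.replicate i (Letter.gen Gen.b) ++ letterPow Gen.a m ++ List.replicate j (Letter.inv Gen.b)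

/-- Crossing `b^i` turns `a^±1` into `a^(±2^i)` at cost `11 (2^i - 1)`; merging it with `a^m` costs
`3 · 2^i`. -/
theorem chain_letterPow_bsForm (k : ℤ) (hk : k.natAbs = 1) (i : ℕ) (m : ℤ) (j : ℕ) :
    Chain bs2 (14 * 2 ^ i) (letterPow Gen.a k ++ bsForm i m j) (bsForm i (2 ^ i * k + m) j) := by
  have h₁ := (chain_letterPow_conj_replicate ab_mem_bs2 k i).append_right
    (letterPow Gen.a m ++ List.replicate j (Letter.inv Gen.b))
  have h₂ := (chain_letterPow_append (R := bs2) Gen.a (2 ^ i * k) m).append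
    (List.replicate i (Letter.gen Gen.b)) (List.replicate j (Letter.inv Gen.b))
  simp only [bsForm, List.append_assoc] at h₁ h₂ ⊢
  refine (h₁.trans h₂).mono ?_
  rw [Int.natAbs_mul, hk, Int.natAbs_pow]
  simp
  omega

/-- Letters are absorbed from the right: `a^±1` adds `±2^i` to `m`, and `b⁻¹` cancels a leading `b`
or, when `i = 0`, doubles `m`. The bound on `|m|` thus doubles per letter and the costs form a
geometric series. The form need not be unique. -/
theorem exists_chain_bsForm (u : Word Gen) (hu : AvoidsC u) :
    ∃ (i j : ℕ) (m : ℤ), i + j ≤ u.length ∧ m.natAbs ≤ 2 ^ u.length ∧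
      Chain bs2 (20 * 2 ^ u.length) u (bsForm i m j) := by
  induction u with
  | nil => exact ⟨0, 0, 0, by simp, by simp, .refl _ _⟩
  | cons x u ih =>
    obtain ⟨i, j, m, hij, hm, h⟩ := ih fun y hy => hu y (List.mem_cons_of_mem _ hy)
    have hx := hu x List.mem_cons_self
    have h := h.cons_left x
    have hpos : 0 < 2 ^ u.length := by positivity
    have hi : 2 ^ i ≤ 2 ^ u.length := Nat.pow_le_pow_right (by norm_num) (by omega)
    rw [List.length_cons, pow_succ]
    have ha : ∀ k : ℤ, k.natAbs = 1 → letterPow Gen.a k = [x] →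
        ∃ (i j : ℕ) (m : ℤ), i + j ≤ u.length + 1 ∧ m.natAbs ≤ 2 ^ u.length * 2 ∧
          Chain bs2 (20 * (2 ^ u.length * 2)) (x :: u) (bsForm i m j) := by
      intro k hk hkx
      refine ⟨i, j, 2 ^ i * k + m, by omega, ?_, ?_⟩
      · refine (Int.natAbs_add_le _ _).trans ?_
        rw [Int.natAbs_mul, hk, Int.natAbs_pow]
        simp
        omega
      · have h' := chain_letterPow_bsForm k hk i m j
        rw [hkx] at h'
        exact (h.trans h').mono (by omega)
    rcases x with _ | (_ | _ | _) | (_ | _ | _)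
    · exact ⟨i, j, m, by omega, by omega,
        (h.trans (Move.delete [] _).chain).mono (by omega)⟩
    · exact ha 1 rfl rfl
    · exact ⟨i + 1, j, m, by omega, by omega, h.mono (by omega)⟩
    · simp at hx
    · exact ha (-1) rfl rfl
    · cases i with
      | zero =>
        refine ⟨0, j + 1, 2 * m, by omega, by rw [Int.natAbs_mul]; simp; omega, ?_⟩
        have h' := (chain_inv_letterPow_conj ab_mem_bs2 m).append_right
          (List.replicate j (Letter.inv Gen.b))
        have e : letterPow Gen.a (2 * m) ++ [Letter.inv Gen.b] ++
            List.replicate j (Letter.inv Gen.b) = bsForm 0 (2 * m) (j + 1) := by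
          simp [bsForm, List.replicate_succ]
        rw [e] at h'
        exact (h.trans h').mono (by omega)
      | succ i =>
        refine ⟨i, j, m, by omega, by omega, ?_⟩
        have h' : Chain bs2 3 (Letter.inv Gen.b :: bsForm (i + 1) m j) (bsForm i m j) :=
          chain_inv_gen Gen.b [] (bsForm i m j)
        exact (h.trans h').mono (by omega)
    · simp at hx

theorem wordValue_bsForm (i : ℕ) (m : ℤ) (j : ℕ) :
    wordValue genPerm (bsForm i m j) = halve ^ i * shift ^ m * (halve ^ j)⁻¹ := by
  simp [bsForm, wordValue_replicate_gen, wordValue_replicate_inv, genPerm, mul_assoc]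

theorem avoidsC_bsForm (i : ℕ) (m : ℤ) (j : ℕ) : AvoidsC (bsForm i m j) := by
  intro x hx
  simp only [bsForm, List.mem_append, List.mem_replicate] at hx
  rcases hx with (⟨_, rfl⟩ | hx) | ⟨_, rfl⟩
  · simp
  · rcases mem_letterPow hx with rfl | rfl <;> simp
  · simp

/-- A word without `c` that represents `b^k` can be transformed into the word `b^k`. -/
theorem chain_letterPow_of_wordValue {u : Word Gen} (hu : AvoidsC u) {k : ℤ}
    (hk : wordValue genPerm u = halve ^ k) :
    k.natAbs ≤ u.length ∧ Chain bs2 (23 * 2 ^ u.length) u (letterPow Gen.b k) := by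
  obtain ⟨i, j, m, hij, hm, h⟩ := exists_chain_bsForm u hu
  have hv : wordValue genPerm (bsForm i m j) = halve ^ k := by
    rw [← hk]
    -- `genPerm` violates `b c = c b²`, so invariance along the chain is taken in `Model` and pulled
    -- back.
    apply HNNExtension.of_injective (φ := sqEquiv)
    rw [hu.of_wordValue, (avoidsC_bsForm i m j).of_wordValue]
    exact (h.wordValue_eq genModel_relations).symm
  rw [wordValue_bsForm] at hv
  have hv' : shift ^ m * halve ^ (-j : ℤ) = halve ^ (k - i) := by
    rw [sub_eq_neg_add, zpow_add, ← hv]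
    simp [mul_assoc]
  -- Powers of `halve` fix `0`, so evaluation there gives `m = 0`.
  have h0 := DFunLike.congr_fun hv' (0 : ℚ)
  simp only [Equiv.Perm.mul_apply, halve_zpow_apply, shift_zpow_apply, zero_div, zero_add,
    Int.cast_eq_zero] at h0
  subst h0
  rw [zpow_zero, one_mul] at hv'
  have hkij : k = (i : ℤ) + -(j : ℤ) := by
    have := halve_zpow_injective hv'
    omega
  subst hkij
  refine ⟨by omega, ?_⟩
  have h' := chain_letterPow_append (R := bs2) Gen.b (i : ℤ) (-(j : ℤ))
  rw [letterPow_neg_natCast, letterPow_natCast] at h'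
  have hl : u.length < 2 ^ u.length := Nat.lt_two_pow_self
  have e : bsForm i 0 j =
      List.replicate i (Letter.gen Gen.b) ++ List.replicate j (Letter.inv Gen.b) := by
    simp [bsForm]
  rw [e] at h
  exact (h.trans h').mono (by simp; omega)

end BaumslagSolitar

/-! ### Upper bound by Britton reduction. -/

section UpperBound

/-- The list represents a reduced sequence `c^ε₁ u₁ c^ε₂ u₂ ⋯` in the sense of Britton's lemma. -/
def IsReduced (l : List (ℤˣ × Word Gen)) : Prop :=
  (∀ p ∈ l, AvoidsC p.2) ∧
    (l.map fun p => (p.1, wordValue genPerm p.2)).IsChain fun x y =>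
      x.2 ∈ HNNExtension.toSubgroup halveSqPowers halvePowers x.1 → x.1 = y.1

/-- The character `c^ε`. -/
def cLetter (ε : ℤˣ) : Letter Gen := if ε = 1 then Letter.gen Gen.c else Letter.inv Gen.c

/-- The word `u c^ε₁ u₁ c^ε₂ u₂ ⋯`. -/
def sequenceWord (u : Word Gen) (l : List (ℤˣ × Word Gen)) : Word Gen :=
  u ++ l.flatMap fun p => cLetter p.1 :: p.2

theorem wordValue_cLetter (ε : ℤˣ) (u : Word Gen) :
    wordValue genModel (cLetter ε :: u) = HNNExtension.t ^ (ε : ℤ) * wordValue genModel u := by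
  rcases Int.units_eq_one_or ε with rfl | rfl <;> simp [cLetter, genModel]

/-- Britton's lemma: a reduced sequence whose product lies in the base group has no stable letter.
-/
theorem eq_nil_of_wordValue_sequenceWord {u : Word Gen} {l : List (ℤˣ × Word Gen)}
    (hu : AvoidsC u) (hl : IsReduced l) (h : wordValue genModel (sequenceWord u l) = 1) :
    l = [] := by
  let w : HNNExtension.NormalWord.ReducedWord (Equiv.Perm ℚ) halveSqPowers halvePowers :=
    { head := wordValue genPerm u
      toList := l.map fun p => (p.1, wordValue genPerm p.2)
      chain := hl.2 }
  have hw : w.prod sqEquiv = wordValue genModel (sequenceWord u l) := by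
    have key : ∀ l : List (ℤˣ × Word Gen), (∀ p ∈ l, AvoidsC p.2) →
        ((l.map fun p => (p.1, wordValue genPerm p.2)).map fun x =>
          (HNNExtension.t ^ (x.1 : ℤ) * HNNExtension.of x.2 : Model)).prod =
        wordValue genModel (l.flatMap fun p => cLetter p.1 :: p.2) := by
      intro l hl
      induction l with
      | nil => simp
      | cons p l ih =>
        have ih := ih fun q hq => hl q (List.mem_cons_of_mem _ hq)
        rw [List.map_cons, List.map_cons, List.prod_cons, ih, List.flatMap_cons,
          wordValue_append, wordValue_cLetter, (hl p List.mem_cons_self).of_wordValue]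
    rw [HNNExtension.NormalWord.ReducedWord.prod, sequenceWord, wordValue_append, ← key l hl.1,
      hu.of_wordValue]
  have := HNNExtension.ReducedWord.toList_eq_nil_of_mem_of_range sqEquiv w
    (by rw [hw, h]; exact one_mem _)
  simpa [w] using this

/-- A pinch `c^ε u c^{-ε}` can be replaced by a power of `b`. -/
theorem chain_pinch {ε : ℤˣ} {u : Word Gen} (hu : AvoidsC u)
    (h : wordValue genPerm u ∈ HNNExtension.toSubgroup halveSqPowers halvePowers ε) :
    ∃ k : ℤ, k.natAbs ≤ 2 * u.length ∧
      Chain bs2 (40 * 2 ^ u.length) (cLetter ε :: (u ++ [cLetter (-ε)])) (letterPow Gen.b k) := by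
  have hl : u.length < 2 ^ u.length := Nat.lt_two_pow_self
  rcases Int.units_eq_one_or ε with rfl | rfl
  · obtain ⟨k, hk⟩ : ∃ k : ℤ, (halve ^ (2 : ℤ)) ^ k = wordValue genPerm u := by
      obtain ⟨k, hk⟩ := h
      exact ⟨k.toAdd, by simpa [zpowersHom_apply] using hk⟩
    rw [← zpow_mul] at hk
    obtain ⟨hk', hc⟩ := chain_letterPow_of_wordValue hu hk.symm
    rw [Int.natAbs_mul] at hk'
    refine ⟨k, by simp at hk'; omega, ?_⟩
    have h₁ := hc.append [Letter.gen Gen.c] [Letter.inv Gen.c]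
    have h₂ := (chain_letterPow_conj bc_mem_bs2 k).symm.append_right [Letter.inv Gen.c]
    have h₃ : Chain bs2 3 (letterPow Gen.b k ++ [Letter.gen Gen.c] ++ [Letter.inv Gen.c])
        (letterPow Gen.b k) := by
      simpa using chain_gen_inv (R := bs2) Gen.c (letterPow Gen.b k) []
    exact (h₁.trans (h₂.trans h₃)).mono (by simp at hk'; omega)
  · obtain ⟨k, hk⟩ : ∃ k : ℤ, halve ^ k = wordValue genPerm u := by
      obtain ⟨k, hk⟩ := h
      exact ⟨k.toAdd, by simpa [zpowersHom_apply] using hk⟩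
    obtain ⟨hk', hc⟩ := chain_letterPow_of_wordValue hu hk.symm
    refine ⟨2 * k, by rw [Int.natAbs_mul]; simp; omega, ?_⟩
    have h₁ := hc.append [Letter.inv Gen.c] [Letter.gen Gen.c]
    have h₂ := (chain_letterPow_conj bc_mem_bs2 k).cons_left (Letter.inv Gen.c)
    have h₃ : Chain bs2 3 (Letter.inv Gen.c :: Letter.gen Gen.c :: letterPow Gen.b (2 * k))
        (letterPow Gen.b (2 * k)) := chain_inv_gen Gen.c [] _
    exact (h₁.trans (h₂.trans h₃)).mono (by omega)

/-- Reducedness puts no condition on the head `u`, so a new `c^ε` creates at most one pinch, and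
removing it leaves a tail of a reduced list: nothing cascades. A pinch around `u` becomes `b^k` with
`|k| ≤ 2 |u|`, hence the doubling of length. -/
theorem exists_chain_sequenceWord (w : Word Gen) :
    ∃ u l, AvoidsC u ∧ IsReduced l ∧ (sequenceWord u l).length ≤ 2 ^ w.length ∧
      Chain bs2 (40 * 2 ^ 2 ^ w.length) w (sequenceWord u l) := by
  induction w with
  | nil => exact ⟨[], [], by simp [AvoidsC], by simp [IsReduced], by simp [sequenceWord],
      .refl _ _⟩
  | cons x w ih =>
    obtain ⟨u, l, hu, hl, hlen, h⟩ := ih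
    have h := h.cons_left x
    have hpos : 0 < 2 ^ w.length := by positivity
    -- One stage costs no more than the whole budget so far, and the budget more than doubles
    -- because `2^l + 1 ≤ 2^(l+1)`.
    have hcost : 40 * 2 ^ 2 ^ w.length + 40 * 2 ^ 2 ^ w.length ≤ 40 * 2 ^ 2 ^ (w.length + 1) := by
      have : 2 ^ 2 ^ w.length * 2 ≤ 2 ^ 2 ^ (w.length + 1) := by
        rw [← pow_succ]
        exact Nat.pow_le_pow_right (by norm_num) (by rw [pow_succ 2 w.length]; omega)
      omega
    rw [List.length_cons]
    by_cases hx : AvoidsC [x]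
    · refine ⟨x :: u, l, hx.append hu, hl, ?_, h.mono (by omega)⟩
      simp only [sequenceWord, List.cons_append, List.length_cons] at hlen ⊢
      omega
    obtain ⟨ε, rfl⟩ : ∃ ε, x = cLetter ε := by
      rcases x with _ | (_ | _ | _) | (_ | _ | _)
      · simp [AvoidsC] at hx
      · simp [AvoidsC] at hx
      · simp [AvoidsC] at hx
      · exact ⟨1, rfl⟩
      · simp [AvoidsC] at hx
      · simp [AvoidsC] at hx
      · exact ⟨-1, rfl⟩
    have hpush : IsReduced ((ε, u) :: l) → ∃ u' l', AvoidsC u' ∧ IsReduced l' ∧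
        (sequenceWord u' l').length ≤ 2 ^ (w.length + 1) ∧
        Chain bs2 (40 * 2 ^ 2 ^ (w.length + 1)) (cLetter ε :: w) (sequenceWord u' l') := by
      intro hred
      refine ⟨[], (ε, u) :: l, by simp [AvoidsC], hred, ?_, h.mono (by omega)⟩
      simp only [sequenceWord, List.nil_append, List.flatMap_cons, List.cons_append,
        List.length_cons] at hlen ⊢
      omega
    rcases l with _ | ⟨⟨δ, v⟩, l⟩
    · exact hpush ⟨by simpa using hu, by simp⟩
    -- Failure of this implication says exactly that `c^ε u c^δ` is a pinch.
    by_cases hred : wordValue genPerm u ∈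
        HNNExtension.toSubgroup halveSqPowers halvePowers ε → ε = δ
    · refine hpush ⟨by simpa using ⟨hu, by simpa using hl.1⟩, ?_⟩
      simpa using ⟨hred, hl.2⟩
    rw [Classical.not_imp] at hred
    obtain ⟨hmem, hne⟩ := hred
    obtain rfl : δ = -ε := by
      rcases Int.units_eq_one_or ε with rfl | rfl <;>
        rcases Int.units_eq_one_or δ with rfl | rfl <;> simp_all
    obtain ⟨k, hk, hc⟩ := chain_pinch hu hmem
    have hv : AvoidsC v := hl.1 _ List.mem_cons_self
    refine ⟨letterPow Gen.b k ++ v, l, (avoidsC_letterPow k).append hv,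
      ⟨fun p hp => hl.1 p (List.mem_cons_of_mem _ hp), ?_⟩, ?_, ?_⟩
    · have := hl.2
      rw [List.map_cons] at this
      exact this.tail
    · simp only [sequenceWord, List.flatMap_cons, List.cons_append, List.length_append,
        List.length_cons, length_letterPow] at hlen ⊢
      omega
    · have hc := hc.append_right (v ++ l.flatMap fun p => cLetter p.1 :: p.2)
      have e : cLetter ε :: (u ++ [cLetter (-ε)]) ++
          (v ++ l.flatMap fun p => cLetter p.1 :: p.2) =
          cLetter ε :: sequenceWord u ((-ε, v) :: l) := by
        simp [sequenceWord]
      rw [e, ← List.append_assoc] at hc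
      refine (h.trans hc).mono (le_trans ?_ hcost)
      have : u.length ≤ 2 ^ w.length := by
        simp only [sequenceWord, List.length_append] at hlen
        omega
      have := Nat.pow_le_pow_right (n := 2) (by norm_num) this
      omega

/-- A word that represents the identity can be transformed into the empty word. -/
theorem chain_nil_of_eval {w : Word Gen} (h : eval bs2 w = 1) :
    Chain bs2 (63 * 2 ^ 2 ^ w.length) w [] := by
  have hw := wordValue_eq_one_of_eval genModel_relations h
  obtain ⟨u, l, hu, hl, hlen, hc⟩ := exists_chain_sequenceWord w
  rw [hc.wordValue_eq genModel_relations] at hw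
  obtain rfl := eq_nil_of_wordValue_sequenceWord hu hl hw
  have e : sequenceWord u [] = u := by simp [sequenceWord]
  rw [e] at hw hlen hc
  have hu1 : wordValue genPerm u = halve ^ (0 : ℤ) := by
    apply HNNExtension.of_injective (φ := sqEquiv)
    simp [hu.of_wordValue, hw]
  have h' := (chain_letterPow_of_wordValue hu hu1).2
  have := Nat.pow_le_pow_right (n := 2) (by norm_num) hlen
  exact (hc.trans h').mono (by omega)

/-- Both words are routed through the empty word, so `126 = 63 + 63`. -/
theorem dehnSector_le (L : ℕ) :
    dehnSector bs2 1 L ≤ (126 * 2 ^ 2 ^ L * (L + 126 * 2 ^ 2 ^ L + 1) : ℕ) := by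
  refine iSup₂_le fun w hw => iSup₂_le fun w' hw' => ?_
  have h := (chain_nil_of_eval hw.2).trans (chain_nil_of_eval hw'.2).symm
  rw [hw.1, hw'.1, ← add_mul] at h
  exact h.dehnDist_le lengthPreserving_bs2 hw.1 hw'.1

end UpperBound

/-! ### Lower bound by a cochain with bounded coboundary. -/

section LowerBound

/-- The affine maps `x ↦ 2 z + 2^(n+1) x` with integral `z`. -/
def IsUpper (g : Equiv.Perm ℚ) : Prop :=
  ∃ (n : ℕ) (z : ℤ), ∀ x, g x = 2 * z + 2 ^ (n + 1) * x

open Classical in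
/-- Half the slope of the maps in `IsUpper`, and zero elsewhere. -/
noncomputable def permWeight (g : Equiv.Perm ℚ) : ℚ := if IsUpper g then (g 1 - g 0) / 2 else 0

theorem permWeight_eq {g : Equiv.Perm ℚ} {n : ℕ} {z : ℤ}
    (h : ∀ x, g x = 2 * z + 2 ^ (n + 1) * x) : permWeight g = 2 ^ n := by
  rw [permWeight, if_pos ⟨n, z, h⟩, h, h, pow_succ]
  ring

theorem permWeight_eq_zero_of_slope {g : Equiv.Perm ℚ} (h : g 1 - g 0 = 1) :
    permWeight g = 0 := by
  refine if_neg ?_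
  rintro ⟨n, z, hg⟩
  have h2 : (1 : ℚ) ≤ 2 ^ n := one_le_pow₀ (by norm_num)
  rw [hg, hg, pow_succ] at h
  linarith

/-- Evenness of the intercept in `IsUpper` exists for this: in `wordWeight_commutatorWord` an
`a⁻¹`-edge of the same slope would otherwise cancel the main term. -/
theorem permWeight_eq_zero_of_odd {g : Equiv.Perm ℚ} (h : g 0 = 1) : permWeight g = 0 := by
  refine if_neg ?_
  rintro ⟨n, z, hg⟩
  rw [hg, mul_zero, add_zero] at h
  have : 2 * z = 1 := by exact_mod_cast h
  omega

/-- The coboundary of `permWeight` is bounded on the cells of the relation `a b = b a²`. -/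
theorem abs_permWeight_cell_le (g : Equiv.Perm ℚ) :
    |permWeight g - (permWeight (g * halve) + permWeight (g * halve * shift))| ≤ 1 := by
  by_cases hg : IsUpper g
  · obtain ⟨n, z, h⟩ := hg
    rw [permWeight_eq h]
    cases n with
    -- At slope 2 the two edges opposite have slope 1 and weight 0: the coboundary is 1.
    | zero =>
      rw [permWeight_eq_zero_of_slope, permWeight_eq_zero_of_slope] <;>
        · simp [Equiv.Perm.mul_apply, h]
          try norm_num
    -- At larger slopes both opposite edges have half the weight, since the shift moves the
    -- intercept by the even number `2^(n+1)`.
    | succ n =>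
      have h₁ : ∀ x, (g * halve) x = 2 * z + 2 ^ (n + 1) * x := by
        intro x
        rw [Equiv.Perm.mul_apply, h, halve_apply, pow_succ]
        ring
      have h₂ : ∀ x, (g * halve * shift) x = 2 * (z + 2 ^ n : ℤ) + 2 ^ (n + 1) * x := by
        intro x
        rw [Equiv.Perm.mul_apply, h₁, shift_apply]
        push_cast
        ring
      rw [permWeight_eq h₁, permWeight_eq h₂, pow_succ, show
        (2 : ℚ) ^ n * 2 - (2 ^ n + 2 ^ n) = 0 by ring]
      simp
  -- Undoing `halve` doubles the slope and undoing `shift` changes the intercept by an even number,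
  -- so either opposite edge being upper would make `g` upper.
  · have h₁ : ¬ IsUpper (g * halve) := by
      rintro ⟨n, z, h⟩
      refine hg ⟨n + 1, z, fun x => ?_⟩
      have := h (x * 2)
      rw [Equiv.Perm.mul_apply, halve_apply, mul_div_cancel_right₀ _ two_ne_zero] at this
      rw [this, pow_succ _ (n + 1)]
      ring
    have h₂ : ¬ IsUpper (g * halve * shift) := by
      rintro ⟨n, z, h⟩
      refine hg ⟨n + 1, z - 2 ^ n, fun x => ?_⟩
      have := h (x * 2 - 1)
      rw [Equiv.Perm.mul_apply, Equiv.Perm.mul_apply, shift_apply, halve_apply, sub_add_cancel,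
        mul_div_cancel_right₀ _ two_ne_zero] at this
      rw [this]
      push_cast
      ring
    rw [permWeight, permWeight, permWeight, if_neg hg, if_neg h₁, if_neg h₂]
    simp

open Classical in
/-- The extension of `permWeight` by zero to the HNN extension. -/
noncomputable def edgeWeight (g : Model) : ℚ :=
  if h : ∃ p, HNNExtension.of p = g then permWeight h.choose else 0

@[simp] theorem edgeWeight_of (p : Equiv.Perm ℚ) :
    edgeWeight (HNNExtension.of p) = permWeight p := by
  have h : ∃ q, (HNNExtension.of q : Model) = HNNExtension.of p := ⟨p, rfl⟩
  rw [edgeWeight, dif_pos h, HNNExtension.of_injective (φ := sqEquiv) h.choose_spec]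

theorem edgeWeight_mul_of_eq_zero {g : Model} (h : ¬ ∃ p, HNNExtension.of p = g)
    (q : Equiv.Perm ℚ) : edgeWeight (g * HNNExtension.of q) = 0 := by
  refine dif_neg ?_
  rintro ⟨p, hp⟩
  exact h ⟨p * q⁻¹, by rw [map_mul, hp, map_inv, mul_inv_cancel_right]⟩

/-- The three edges start in one left coset of the base group: either `permWeight` sees them all or
all weights vanish. -/
theorem abs_edgeWeight_cell_le (g : Model) :
    |edgeWeight g - (edgeWeight (g * HNNExtension.of halve) +
      edgeWeight (g * HNNExtension.of halve * HNNExtension.of shift))| ≤ 1 := by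
  by_cases h : ∃ p, HNNExtension.of p = g
  · obtain ⟨p, rfl⟩ := h
    simpa only [← map_mul, edgeWeight_of] using abs_permWeight_cell_le p
  · have h₁ := edgeWeight_mul_of_eq_zero h halve
    have h₂ := edgeWeight_mul_of_eq_zero h (halve * shift)
    have h₀ := edgeWeight_mul_of_eq_zero h 1
    rw [map_one, mul_one] at h₀
    rw [map_mul, ← mul_assoc] at h₂
    rw [h₀, h₁, h₂]
    simp

/-- The signed weight of the `a`-edge that a character traverses from the vertex `g`. -/
noncomputable def letterWeight (g : Model) : Letter Gen → ℚ
  | Letter.gen Gen.a => edgeWeight g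
  | Letter.inv Gen.a => -edgeWeight (g * (HNNExtension.of shift)⁻¹)
  | _ => 0

/-- The sum of the signed weights along the path of a word from the vertex `g`. -/
noncomputable def wordWeight : Model → Word Gen → ℚ
  | _, [] => 0
  | g, x :: w => letterWeight g x + wordWeight (g * wordValue genModel [x]) w

theorem wordWeight_append (g : Model) (u v : Word Gen) :
    wordWeight g (u ++ v) = wordWeight g u + wordWeight (g * wordValue genModel u) v := by
  induction u generalizing g with
  | nil => simp [wordWeight]
  | cons x u ih =>
    rw [List.cons_append, wordWeight, wordWeight, ih, add_assoc, mul_assoc, ← wordValue_append]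
    rfl

theorem wordWeight_eq_zero {w : Word Gen}
    (h : ∀ x ∈ w, x ≠ Letter.gen Gen.a ∧ x ≠ Letter.inv Gen.a) (g : Model) :
    wordWeight g w = 0 := by
  induction w generalizing g with
  | nil => rfl
  | cons x w ih =>
    rw [wordWeight, ih fun y hy => h y (List.mem_cons_of_mem _ hy)]
    have hx := h x List.mem_cons_self
    rcases x with _ | (_ | _ | _) | (_ | _ | _) <;> simp_all [letterWeight]

theorem wordWeight_trivialWord (g : Model) (m : ℕ) : wordWeight g (trivialWord Gen m) = 0 :=
  wordWeight_eq_zero (fun x hx => by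
    obtain rfl := List.eq_of_mem_replicate hx
    simp) g

/-- The relation `b c = c b²` has no `a`-edge, a cancelling pair traverses one edge in both
directions, and `e` has no weight; only `a b = b a²` contributes. -/
theorem abs_wordWeight_localRelation_le {l r : Word Gen} (h : LocalRelation bs2 l r)
    (g : Model) : |wordWeight g l - wordWeight g r| ≤ 1 := by
  cases h with
  | given h =>
    rcases h with h | h
    · obtain ⟨rfl, rfl⟩ := Prod.mk.inj h
      simpa [wordWeight, letterWeight, genModel] using abs_edgeWeight_cell_le g
    · obtain ⟨rfl, rfl⟩ := Prod.mk.inj h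
      simp [wordWeight, letterWeight]
  | gen_inv s => cases s <;> simp [wordWeight, letterWeight, genModel]
  | inv_gen s => cases s <;> simp [wordWeight, letterWeight, genModel]
  | slide x => rcases x with _ | (_ | _ | _) | (_ | _ | _) <;> simp [wordWeight, letterWeight]

theorem Step.abs_wordWeight_le {u v : Word Gen} (h : Step bs2 u v) (g : Model) :
    |wordWeight g u - wordWeight g v| ≤ 1 := by
  obtain ⟨p, l, r, q, h, rfl, rfl⟩ := h
  have hv : wordValue genModel l = wordValue genModel r :=
    h.elim (wordValue_localRelation genModel_relations)
      fun h => (wordValue_localRelation genModel_relations h).symm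
  have hw : |wordWeight (g * wordValue genModel p) l -
      wordWeight (g * wordValue genModel p) r| ≤ 1 := by
    rcases h with h | h
    · exact abs_wordWeight_localRelation_le h _
    · rw [abs_sub_comm]
      exact abs_wordWeight_localRelation_le h _
  simpa [wordWeight_append, hv] using hw

theorem Derivation.abs_wordWeight_le {n : ℕ} {u v : Word Gen} (h : Derivation bs2 n u v)
    (g : Model) : |wordWeight g u - wordWeight g v| ≤ n := by
  induction h with
  | refl u => simp
  | cons h d ih =>
    refine (abs_sub_le _ _ _).trans ((add_le_add (h.abs_wordWeight_le g) ih).trans ?_)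
    push_cast
    linarith

/-- Since `e` carries no weight, the bound holds whatever the padding. -/
theorem le_dehnDist_of_wordWeight {w : Word Gen} {N L : ℕ} (h : wordWeight 1 w = N) :
    (N : ℕ∞) ≤ dehnDist bs2 w (trivialWord Gen L) := by
  refine le_iInf₂ fun n hn => ?_
  obtain ⟨m, d⟩ := hn
  have hd := d.abs_wordWeight_le 1
  simp only [wordWeight_append, wordWeight_trivialWord, h, add_zero, sub_zero] at hd
  rw [abs_of_nonneg (by positivity)] at hd
  exact_mod_cast hd

/-! ### Short trivial words of doubly exponential weight. -/

/-- The word `c^{-n} x c^n`. -/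
def cConj (n : ℕ) (x : Letter Gen) : Word Gen :=
  List.replicate n (Letter.inv Gen.c) ++ [x] ++ List.replicate n (Letter.gen Gen.c)

/-- The commutator of `u⁻¹ a u` and `a`, where `u = c^{-n} b c^n`. -/
def commutatorWord (n : ℕ) : Word Gen :=
  cConj n (Letter.inv Gen.b) ++ [Letter.gen Gen.a] ++
    cConj n (Letter.gen Gen.b) ++ [Letter.gen Gen.a] ++
    cConj n (Letter.inv Gen.b) ++ [Letter.inv Gen.a] ++
    cConj n (Letter.gen Gen.b) ++ [Letter.inv Gen.a]

theorem length_commutatorWord (n : ℕ) : (commutatorWord n).length = 8 * n + 8 := by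
  simp [commutatorWord, cConj]
  ring

/-- Used twice: for `b, c` with exponent `n`, then for `a, b` with exponent `2^n`, which stacks the
two exponentials. -/
theorem inv_pow_mul_mul_pow {H : Type*} [Group H] {x y : H} (h : x * y = y * (x * x)) (n : ℕ) :
    (y ^ n)⁻¹ * x * y ^ n = x ^ 2 ^ n := by
  have key : ∀ m : ℕ, x ^ m * y = y * x ^ (m * 2) := by
    intro m
    have h' : SemiconjBy y (x * x) x := h.symm
    rw [← (h'.pow_right m).eq, mul_comm m, pow_mul, pow_two]
  have : x * y ^ n = y ^ n * x ^ 2 ^ n := by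
    induction n with
    | zero => simp
    | succ n ih => rw [pow_succ, ← mul_assoc, ih, mul_assoc, key, ← mul_assoc, pow_succ 2]
  rw [mul_assoc, this, inv_mul_cancel_left]

section

variable {H : Type*} [Group H] {f : Gen → H}
  (hbc : f Gen.b * f Gen.c = f Gen.c * (f Gen.b * f Gen.b))
include hbc

theorem wordValue_cConj_gen (n : ℕ) :
    wordValue f (cConj n (Letter.gen Gen.b)) = f Gen.b ^ 2 ^ n := by
  rw [← inv_pow_mul_mul_pow hbc]
  simp [cConj, wordValue_replicate_gen, wordValue_replicate_inv, mul_assoc]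

theorem wordValue_cConj_inv (n : ℕ) :
    wordValue f (cConj n (Letter.inv Gen.b)) = (f Gen.b ^ 2 ^ n)⁻¹ := by
  rw [← inv_pow_mul_mul_pow hbc]
  simp [cConj, wordValue_replicate_gen, wordValue_replicate_inv, mul_assoc]

theorem wordValue_commutatorWord (hab : f Gen.a * f Gen.b = f Gen.b * (f Gen.a * f Gen.a))
    (n : ℕ) : wordValue f (commutatorWord n) = 1 := by
  have h := inv_pow_mul_mul_pow hab (2 ^ n)
  have h' : (f Gen.b ^ 2 ^ n)⁻¹ * (f Gen.a)⁻¹ * f Gen.b ^ 2 ^ n = (f Gen.a ^ 2 ^ 2 ^ n)⁻¹ := by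
    rw [← h]
    group
  have e : wordValue f (commutatorWord n) =
      ((f Gen.b ^ 2 ^ n)⁻¹ * f Gen.a * f Gen.b ^ 2 ^ n) * f Gen.a *
        ((f Gen.b ^ 2 ^ n)⁻¹ * (f Gen.a)⁻¹ * f Gen.b ^ 2 ^ n) * (f Gen.a)⁻¹ := by
    simp [commutatorWord, wordValue_cConj_gen hbc, wordValue_cConj_inv hbc, mul_assoc]
  rw [e, h, h', ← pow_succ, pow_succ']
  group

end

theorem eval_commutatorWord (n : ℕ) : eval bs2 (commutatorWord n) = 1 := by
  have hab := eval_eq_of_mem ab_mem_bs2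
  have hbc := eval_eq_of_mem bc_mem_bs2
  simp only [eval_eq_wordValue, wordValue_gen, wordValue_e, wordValue_nil, mul_one] at hab hbc
  rw [eval_eq_wordValue]
  exact wordValue_commutatorWord hbc hab n

theorem wordWeight_cConj (g : Model) (n : ℕ) {x : Letter Gen}
    (h : x ≠ Letter.gen Gen.a ∧ x ≠ Letter.inv Gen.a) : wordWeight g (cConj n x) = 0 := by
  refine wordWeight_eq_zero (fun y hy => ?_) g
  simp only [cConj, List.mem_append, List.mem_replicate, List.mem_singleton] at hy
  rcases hy with (⟨_, rfl⟩ | rfl) | ⟨_, rfl⟩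
  · simp
  · exact h
  · simp

/-- Only the first `a` counts: its edge starts at `b^(-2^n)`, of slope `2^(2^n)` and intercept 0.
The third `a`-edge has the same slope but intercept 1; the other two have slope 1. -/
theorem wordWeight_commutatorWord (n : ℕ) :
    wordWeight 1 (commutatorWord n) = 2 ^ (2 ^ n - 1) := by
  have hbc : genModel Gen.b * genModel Gen.c =
      genModel Gen.c * (genModel Gen.b * genModel Gen.b) := halve_mul_t
  have hg : ∀ g, wordWeight g (cConj n (Letter.gen Gen.b)) = 0 :=
    fun g => wordWeight_cConj g n (by simp)
  have hi : ∀ g, wordWeight g (cConj n (Letter.inv Gen.b)) = 0 :=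
    fun g => wordWeight_cConj g n (by simp)
  set p : Equiv.Perm ℚ := halve ^ 2 ^ n with hp
  have hpx : ∀ x, p x = x / 2 ^ 2 ^ n := by
    intro x
    have := halve_zpow_apply ((2 ^ n : ℕ) : ℤ) x
    rwa [zpow_natCast, zpow_natCast] at this
  have hpi : ∀ x, p⁻¹ x = 2 ^ 2 ^ n * x := by
    intro x
    rw [Equiv.Perm.inv_eq_iff_eq, hpx]
    field_simp
  have hsi : ∀ x, (shift⁻¹ : Equiv.Perm ℚ) x = x - 1 := by
    intro x
    rw [Equiv.Perm.inv_eq_iff_eq, shift_apply]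
    ring
  have e : wordWeight 1 (commutatorWord n) =
      permWeight p⁻¹ - permWeight (p⁻¹ * shift * p * shift * p⁻¹ * shift⁻¹) +
        permWeight (p⁻¹ * shift * p) -
          permWeight (p⁻¹ * shift * p * shift * p⁻¹ * shift⁻¹ * p * shift⁻¹) := by
    simp only [commutatorWord, wordWeight_append, hg, hi, wordWeight, letterWeight,
      wordValue_append, wordValue_cConj_gen hbc, wordValue_cConj_inv hbc, wordValue_gen,
      wordValue_inv, wordValue_nil, genModel, ← map_pow, ← map_inv, ← map_mul, edgeWeight_of,
      one_mul, mul_one, ← hp]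
    ring
  have hN : 2 ^ n = 2 ^ n - 1 + 1 := (Nat.sub_add_cancel Nat.one_le_two_pow).symm
  have h₁ : permWeight p⁻¹ = 2 ^ (2 ^ n - 1) := by
    refine permWeight_eq (z := 0) fun x => ?_
    rw [hpi, ← hN]
    simp
  have h₂ : permWeight (p⁻¹ * shift * p * shift * p⁻¹ * shift⁻¹) = 0 := by
    refine permWeight_eq_zero_of_odd ?_
    simp only [Equiv.Perm.mul_apply, hpx, hpi, hsi, shift_apply]
    field_simp
    ring
  have h₃ : permWeight (p⁻¹ * shift * p) = 0 := by
    refine permWeight_eq_zero_of_slope ?_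
    simp only [Equiv.Perm.mul_apply, hpx, hpi, shift_apply]
    field_simp
    ring
  have h₄ : permWeight (p⁻¹ * shift * p * shift * p⁻¹ * shift⁻¹ * p * shift⁻¹) = 0 := by
    refine permWeight_eq_zero_of_slope ?_
    simp only [Equiv.Perm.mul_apply, hpx, hpi, hsi, shift_apply]
    field_simp
    ring
  rw [e, h₁, h₂, h₃, h₄]
  ring

theorem le_dehn {n L : ℕ} (h : 8 * n + 8 ≤ L) : ((2 ^ (2 ^ n - 1) : ℕ) : ℕ∞) ≤ dehn bs2 L := by
  refine le_iSup₂_of_le (commutatorWord n ++ trivialWord Gen (L - (8 * n + 8))) ⟨?_, ?_⟩ ?_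
  · simp [length_commutatorWord]
    omega
  · rw [eval_eq_wordValue, wordValue_append, wordValue_trivialWord, mul_one, ← eval_eq_wordValue,
      eval_commutatorWord]
  · apply le_dehnDist_of_wordWeight
    rw [wordWeight_append, wordWeight_trivialWord, wordWeight_commutatorWord]
    simp

end LowerBound

/-! ### Comparison with `2^(2^L)`, for anything between `dehn` and `dehnSector`. -/

theorem scalesAs_doubleExp {d : ℕ → ℕ∞} (h₁ : ∀ L, dehn bs2 L ≤ d L)
    (h₂ : ∀ L, d L ≤ dehnSector bs2 1 L) :
    ScalesAs d fun x : ℝ => (2 : ℝ) ^ ((2 : ℝ) ^ x) := by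
  refine ⟨16, by norm_num, eventually_atTop.2 ⟨40, fun L hL => ⟨?_, ?_⟩⟩⟩
  -- The largest `n` whose commutator word fits in length `L`; `n ≥ 4` is what `L / 16 ≤ n - 1`
  -- requires.
  · obtain ⟨n, hn, hL₁, hL₂⟩ : ∃ n, 4 ≤ n ∧ 8 * n + 8 ≤ L ∧ L < 8 * n + 16 :=
      ⟨L / 8 - 1, by omega, by omega, by omega⟩
    have h := ENat.toENNReal_le.2 ((le_dehn hL₁).trans (h₁ L))
    rw [ENat.toENNReal_coe] at h
    refine le_trans ?_ h
    rw [← ENNReal.ofReal_natCast]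
    refine ENNReal.ofReal_le_ofReal ?_
    push_cast
    rw [← Real.rpow_natCast]
    refine Real.rpow_le_rpow_of_exponent_le (by norm_num) ?_
    have hx : (L : ℝ) / 16 ≤ ((n - 1 : ℕ) : ℝ) := by
      rw [Nat.cast_sub (by omega)]
      have : (L : ℝ) < 8 * n + 16 := by exact_mod_cast hL₂
      have : (4 : ℝ) ≤ n := by exact_mod_cast hn
      push_cast
      linarith
    refine (Real.rpow_le_rpow_of_exponent_le (by norm_num) hx).trans ?_
    rw [Real.rpow_natCast]
    have : 2 ^ (n - 1) ≤ 2 ^ n - 1 := by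
      obtain ⟨m, rfl⟩ := Nat.exists_eq_add_of_le' (show 1 ≤ n by omega)
      have := Nat.one_le_two_pow (n := m)
      rw [Nat.add_sub_cancel, pow_succ]
      omega
    exact_mod_cast this
  · have h := ENat.toENNReal_le.2 ((h₂ L).trans (dehnSector_le L))
    rw [ENat.toENNReal_coe] at h
    refine h.trans ?_
    rw [← ENNReal.ofReal_natCast]
    refine ENNReal.ofReal_le_ofReal ?_
    have e : (2 : ℝ) ^ ((2 : ℝ) ^ ((16 : ℝ) * L)) = ((2 ^ 2 ^ (16 * L) : ℕ) : ℝ) := by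
      push_cast
      rw [← Real.rpow_natCast 2 (2 ^ (16 * L))]
      push_cast
      rw [← Real.rpow_natCast 2 (16 * L)]
      push_cast
      rfl
    beta_reduce
    rw [e, Nat.cast_le]
    have hX : L + 1 ≤ 2 ^ 2 ^ L :=
      Nat.lt_two_pow_self.trans Nat.lt_two_pow_self
    -- Both factors of the bound are at most `128 · 2^(2^L)`, and `128² = 2^14`.
    have hexp : 14 + 2 * 2 ^ L ≤ 2 ^ (16 * L) :=
      calc 14 + 2 * 2 ^ L ≤ 2 ^ (L + 4) := by
            have := Nat.one_le_two_pow (n := L)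
            rw [pow_add]
            omega
        _ ≤ 2 ^ (16 * L) := Nat.pow_le_pow_right (by norm_num) (by omega)
    calc 126 * 2 ^ 2 ^ L * (L + 126 * 2 ^ 2 ^ L + 1)
        ≤ 128 * 2 ^ 2 ^ L * (128 * 2 ^ 2 ^ L) := Nat.mul_le_mul (by omega) (by omega)
      _ = 2 ^ (14 + 2 * 2 ^ L) := by
        rw [pow_add, two_mul, pow_add]
        ring
      _ ≤ 2 ^ 2 ^ (16 * L) := Nat.pow_le_pow_right (by norm_num) hexp

end IteratedBS

theorem mainTheorem2 :
    IteratedBS.ScalesAs (IteratedBS.dehn IteratedBS.bs2)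
        (fun x : ℝ => (2 : ℝ) ^ ((2 : ℝ) ^ x)) ∧
      IteratedBS.ScalesAs (IteratedBS.dehnSector IteratedBS.bs2 1)
        (fun x : ℝ => (2 : ℝ) ^ ((2 : ℝ) ^ x)) :=
  ⟨IteratedBS.scalesAs_doubleExp (fun _ => le_rfl) IteratedBS.dehn_le_dehnSector,
    IteratedBS.scalesAs_doubleExp IteratedBS.dehn_le_dehnSector fun _ => le_rfl⟩
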